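/- Call a homomorphism of lattices $f\colon K\to L$ lower bounded if, for every $b\in L$, the set $\{x\in K : b\le f(x)\}$ is either empty or has a least element, and call a lattice $L$ lower bounded if every lattice homomorphism from a finitely generated free lattice to $L$ is lower bounded ($L$ itself need not be finitely generated). A lattice $M$ is lower continuous if $a\vee\bigwedge X=\bigwedge\{a\vee x : x\in X\}$ for every $a\in M$ and every downward directed $X\subseteq M$ such that $\bigwedge X$ exists, and it is join-semidistributive if $x\vee y=x\vee z$ implies $x\vee y=x\vee(y\wedge z)$ for all $x,y,z\in M$. Every lower bounded lattice has a lattice embedding (an injective map preserving binary joins and meets) into some complete, lower continuous, join-semidistributive lattice. -/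

import Mathlib

/-- Lattice terms (words in `⊔` and `⊓`) over a set `X` of variables. -/
inductive LatticeTerm (X : Type*) : Type _
  | var (x : X) : LatticeTerm X
  | join (s t : LatticeTerm X) : LatticeTerm X
  | meet (s t : LatticeTerm X) : LatticeTerm X

namespace LatticeTerm

/-- `Le s t`: the inequality `s ≤ t` is derivable from the lattice axioms, that is, it holds
identically in all lattices. -/
inductive Le {X : Type*} : LatticeTerm X → LatticeTerm X → Prop
  | refl (s : LatticeTerm X) : Le s s
  | trans {s t u : LatticeTerm X} : Le s t → Le t u → Le s u
  | le_join_left (s t : LatticeTerm X) : Le s (join s t)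
  | le_join_right (s t : LatticeTerm X) : Le t (join s t)
  | join_le {s t u : LatticeTerm X} : Le s u → Le t u → Le (join s t) u
  | meet_le_left (s t : LatticeTerm X) : Le (meet s t) s
  | meet_le_right (s t : LatticeTerm X) : Le (meet s t) t
  | le_meet {s t u : LatticeTerm X} : Le s t → Le s u → Le s (meet t u)

/-- Two terms are equivalent if each is below the other. -/
def setoid (X : Type*) : Setoid (LatticeTerm X) where
  r s t := Le s t ∧ Le t s
  iseqv :=
    { refl := fun s => ⟨Le.refl s, Le.refl s⟩
      symm := fun h => ⟨h.2, h.1⟩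
      trans := fun h k => ⟨h.1.trans k.1, k.2.trans h.2⟩ }

/-- The value of a term in a lattice, under an assignment of the variables. -/
def eval {X L : Type*} [Lattice L] (g : X → L) : LatticeTerm X → L
  | var x => g x
  | join s t => eval g s ⊔ eval g t
  | meet s t => eval g s ⊓ eval g t

theorem Le.eval_le {X L : Type*} [Lattice L] (g : X → L) {s t : LatticeTerm X} (h : Le s t) :
    eval g s ≤ eval g t := by
  induction h with
  | refl s => exact le_refl _
  | trans _ _ h₁ h₂ => exact h₁.trans h₂
  | le_join_left s t => exact le_sup_left
  | le_join_right s t => exact le_sup_right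
  | join_le _ _ h₁ h₂ => exact sup_le h₁ h₂
  | meet_le_left s t => exact inf_le_left
  | meet_le_right s t => exact inf_le_right
  | le_meet _ _ h₁ h₂ => exact le_inf h₁ h₂

end LatticeTerm

/-- The free lattice on a set `X` (without bounds; it is empty if `X` is empty). -/
def FreeLattice (X : Type*) : Type _ := Quotient (LatticeTerm.setoid X)

namespace FreeLattice

open LatticeTerm

instance instLattice (X : Type*) : Lattice (FreeLattice X) where
  le := Quotient.lift₂ Le fun _ _ _ _ h k =>
    propext ⟨fun l => (h.2.trans l).trans k.1, fun l => (h.1.trans l).trans k.2⟩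
  le_refl := by rintro ⟨s⟩; exact Le.refl s
  le_trans := by rintro ⟨s⟩ ⟨t⟩ ⟨u⟩; exact Le.trans
  le_antisymm := by rintro ⟨s⟩ ⟨t⟩ h k; exact Quotient.sound ⟨h, k⟩
  sup := Quotient.map₂ join fun _ _ h _ _ k =>
    ⟨Le.join_le (h.1.trans (Le.le_join_left _ _)) (k.1.trans (Le.le_join_right _ _)),
      Le.join_le (h.2.trans (Le.le_join_left _ _)) (k.2.trans (Le.le_join_right _ _))⟩
  inf := Quotient.map₂ meet fun _ _ h _ _ k =>
    ⟨Le.le_meet ((Le.meet_le_left _ _).trans h.1) ((Le.meet_le_right _ _).trans k.1),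
      Le.le_meet ((Le.meet_le_left _ _).trans h.2) ((Le.meet_le_right _ _).trans k.2)⟩
  le_sup_left := by rintro ⟨s⟩ ⟨t⟩; exact Le.le_join_left s t
  le_sup_right := by rintro ⟨s⟩ ⟨t⟩; exact Le.le_join_right s t
  sup_le := by rintro ⟨s⟩ ⟨t⟩ ⟨u⟩; exact Le.join_le
  inf_le_left := by rintro ⟨s⟩ ⟨t⟩; exact Le.meet_le_left s t
  inf_le_right := by rintro ⟨s⟩ ⟨t⟩; exact Le.meet_le_right s t
  le_inf := by rintro ⟨s⟩ ⟨t⟩ ⟨u⟩; exact Le.le_meet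

/-- The free generators. -/
def of {X : Type*} (x : X) : FreeLattice X := Quotient.mk _ (var x)

/-- Every element is obtained from the generators by finitely many joins and meets. -/
theorem induction {X : Type*} {p : FreeLattice X → Prop} (hof : ∀ x, p (of x))
    (hsup : ∀ a b, p a → p b → p (a ⊔ b)) (hinf : ∀ a b, p a → p b → p (a ⊓ b))
    (a : FreeLattice X) : p a := by
  obtain ⟨s⟩ := a
  induction s with
  | var x => exact hof x
  | join s t hs ht => exact hsup _ _ hs ht
  | meet s t hs ht => exact hinf _ _ hs ht

/-- The homomorphism that extends a map from the generators to a lattice. -/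
def lift {X L : Type*} [Lattice L] (g : X → L) : LatticeHom (FreeLattice X) L where
  toFun := Quotient.lift (eval g) fun _ _ h => le_antisymm (h.1.eval_le g) (h.2.eval_le g)
  map_sup' := by rintro ⟨s⟩ ⟨t⟩; rfl
  map_inf' := by rintro ⟨s⟩ ⟨t⟩; rfl

/-- The universal property of the free lattice. -/
theorem existsUnique_lift {X L : Type*} [Lattice L] (g : X → L) :
    ∃! f : LatticeHom (FreeLattice X) L, ∀ x, f (of x) = g x := by
  refine ⟨lift g, fun x => rfl, fun f hf => DFunLike.ext _ _ (induction hf ?_ ?_)⟩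
  · intro a b ha hb
    rw [map_sup, map_sup, ha, hb]
  · intro a b ha hb
    rw [map_inf, map_inf, ha, hb]

end FreeLattice

/-- A lattice homomorphism is lower bounded if the preimage of any principal filter is either
empty or has a least element. -/
def IsLowerBoundedHom {K L : Type*} [Lattice K] [Lattice L] (f : LatticeHom K L) : Prop :=
  ∀ b : L, f ⁻¹' Set.Ici b = ∅ ∨ ∃ a : K, IsLeast (f ⁻¹' Set.Ici b) a

/-- A lattice `L` is lower bounded if every homomorphism from a finitely generated free lattice
to `L` is lower bounded. -/
def IsLowerBoundedLattice (L : Type*) [Lattice L] : Prop :=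
  ∀ (n : ℕ) (f : LatticeHom (FreeLattice (Fin n)) L), IsLowerBoundedHom f

/-- A lattice is lower continuous if `a ⊔ ⋀ X = ⋀ {a ⊔ x | x ∈ X}` whenever `X` is downward
directed and `⋀ X` exists; the existence of the meet on the right is part of the equality. -/
def IsLowerContinuous (L : Type*) [Lattice L] : Prop :=
  ∀ (a : L) (X : Set L), X.Nonempty → DirectedOn (· ≥ ·) X →
    ∀ m : L, IsGLB X m → IsGLB ((fun x => a ⊔ x) '' X) (a ⊔ m)

/-- A lattice is join-semidistributive if `x ⊔ y = x ⊔ z` implies `x ⊔ y = x ⊔ (y ⊓ z)`. -/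
def IsJoinSemidistributive (L : Type*) [Lattice L] : Prop :=
  ∀ x y z : L, x ⊔ y = x ⊔ z → x ⊔ y = x ⊔ (y ⊓ z)

universe u

/-!
Call a meet `⋀ wₙ = m` in `L` *stable* if it is preserved by all unary polynomials of the form
`t x = (((x ∘ c₁) ∘ c₂) ∘ ⋯) ∘ cₖ`, each `∘` being `⊔` or `⊓`. The lattice `M` consists of the filters
of `L` (the empty one included) that are closed under stable meets of sequences, ordered by reverse
inclusion; `L` embeds by `a ↦ ↑a`. Stable meets remain stable after joining or meeting with a
constant, which has two consequences: closing a filter under stable meets again gives a filter, and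
`M` is lower continuous (`StableFilter.isLowerContinuous`): to show that `p` lies in a stable filter
`K`, it suffices that `{q | p ⊔ q ∈ K}`, again closed under stable meets, contains a set of generators
of a stable filter to which `p` belongs.

Given `x`, `y`, `z`, put `y₀ = y`, `z₀ = z`, `yₙ₊₁ = y ⊓ (x ⊔ zₙ)`, `zₙ₊₁ = z ⊓ (x ⊔ yₙ)`. If the
meet `⋀ (x ⊔ yₙ) = x ⊔ (y ⊓ z)` is always stable, the same argument shows that `M` is
join-semidistributive (`StableFilter.isJoinSemidistributive`). This stability holds in every lower
bounded lattice: a lower bounded homomorphism onto the sublattice generated by the finitely many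
elements concerned reduces it to free lattices. In a free lattice, Whitman's condition and the
join-primeness of the generators show, by induction on the elements below the meet, both that the
meet is as claimed (`FreeLattice.isGLB_sup_jsdSeq`) and that joining with a constant preserves meets
of decreasing sequences (`FreeLattice.isGLB_sup_left`). Whitman's condition is read off from a
cut-free calculus for the inequalities between lattice terms.
-/

/-! ### Whitman's condition in free lattices -/

namespace LatticeTerm

/-- The cut-free calculus for inequalities between lattice terms: transitivity is not a rule. -/
inductive CutFree {X : Type*} : LatticeTerm X → LatticeTerm X → Prop
  | var (x : X) : CutFree (var x) (var x)
  | join_le {s t u : LatticeTerm X} : CutFree s u → CutFree t u → CutFree (join s t) u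
  | le_meet {s t u : LatticeTerm X} : CutFree s t → CutFree s u → CutFree s (meet t u)
  | meet_le_left {s u : LatticeTerm X} (t : LatticeTerm X) : CutFree s u → CutFree (meet s t) u
  | meet_le_right {t u : LatticeTerm X} (s : LatticeTerm X) : CutFree t u → CutFree (meet s t) u
  | le_join_left {s t : LatticeTerm X} (u : LatticeTerm X) : CutFree s t → CutFree s (join t u)
  | le_join_right {s u : LatticeTerm X} (t : LatticeTerm X) : CutFree s u → CutFree s (join t u)

namespace CutFree

variable {X : Type*}

theorem refl (s : LatticeTerm X) : CutFree s s := by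
  induction s with
  | var x => exact var x
  | join s t hs ht => exact join_le (le_join_left t hs) (le_join_right s ht)
  | meet s t hs ht => exact le_meet (meet_le_left t hs) (meet_le_right s ht)

theorem of_join_le {s t u : LatticeTerm X} (h : CutFree (join s t) u) :
    CutFree s u ∧ CutFree t u := by
  generalize hr : join s t = r at h
  induction h with
  | var x => cases hr
  | join_le h k => cases hr; exact ⟨h, k⟩
  | le_meet _ _ h k => exact ⟨le_meet (h hr).1 (k hr).1, le_meet (h hr).2 (k hr).2⟩
  | meet_le_left => cases hr
  | meet_le_right => cases hr
  | le_join_left u _ h => exact ⟨le_join_left u (h hr).1, le_join_left u (h hr).2⟩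
  | le_join_right t _ h => exact ⟨le_join_right t (h hr).1, le_join_right t (h hr).2⟩

theorem of_le_meet {s t u : LatticeTerm X} (h : CutFree s (meet t u)) :
    CutFree s t ∧ CutFree s u := by
  generalize hr : meet t u = r at h
  induction h with
  | var x => cases hr
  | join_le _ _ h k => exact ⟨join_le (h hr).1 (k hr).1, join_le (h hr).2 (k hr).2⟩
  | le_meet h k => cases hr; exact ⟨h, k⟩
  | meet_le_left t _ h => exact ⟨meet_le_left t (h hr).1, meet_le_left t (h hr).2⟩
  | meet_le_right s _ h => exact ⟨meet_le_right s (h hr).1, meet_le_right s (h hr).2⟩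
  | le_join_left => cases hr
  | le_join_right => cases hr

/-- Cut elimination, by induction on the cut term `t`. -/
theorem trans {s t u : LatticeTerm X} (h : CutFree s t) (k : CutFree t u) : CutFree s u := by
  induction t generalizing s u with
  | var x =>
    generalize hr : LatticeTerm.var x = r at h
    induction h with
    | var y => cases hr; exact k
    | join_le _ _ h₁ h₂ => exact join_le (h₁ hr) (h₂ hr)
    | le_meet => cases hr
    | meet_le_left t _ h => exact meet_le_left t (h hr)
    | meet_le_right s _ h => exact meet_le_right s (h hr)
    | le_join_left => cases hr
    | le_join_right => cases hr
  | join t₁ t₂ ih₁ ih₂ =>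
    generalize hr : join t₁ t₂ = r at h
    induction h with
    | var y => cases hr
    | join_le _ _ h₁ h₂ => exact join_le (h₁ hr) (h₂ hr)
    | le_meet => cases hr
    | meet_le_left t _ h => exact meet_le_left t (h hr)
    | meet_le_right s _ h => exact meet_le_right s (h hr)
    | le_join_left _ h => cases hr; exact ih₁ h (of_join_le k).1
    | le_join_right _ h => cases hr; exact ih₂ h (of_join_le k).2
  | meet t₁ t₂ ih₁ ih₂ =>
    generalize hr : meet t₁ t₂ = r at k
    induction k with
    | var y => cases hr
    | join_le => cases hr
    | le_meet _ _ k₁ k₂ => exact le_meet (k₁ hr) (k₂ hr)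
    | meet_le_left _ k => cases hr; exact ih₁ (of_le_meet h).1 k
    | meet_le_right _ k => cases hr; exact ih₂ (of_le_meet h).2 k
    | le_join_left u _ k => exact le_join_left u (k hr)
    | le_join_right t _ k => exact le_join_right t (k hr)

theorem le {s t : LatticeTerm X} (h : CutFree s t) : Le s t := by
  induction h with
  | var x => exact Le.refl _
  | join_le _ _ h k => exact Le.join_le h k
  | le_meet _ _ h k => exact Le.le_meet h k
  | meet_le_left t _ h => exact (Le.meet_le_left _ t).trans h
  | meet_le_right s _ h => exact (Le.meet_le_right s _).trans h
  | le_join_left u _ h => exact h.trans (Le.le_join_left _ u)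
  | le_join_right t _ h => exact h.trans (Le.le_join_right t _)

end CutFree

theorem Le.cutFree {X : Type*} {s t : LatticeTerm X} (h : Le s t) : CutFree s t := by
  induction h with
  | refl s => exact CutFree.refl s
  | trans _ _ h k => exact h.trans k
  | le_join_left s t => exact CutFree.le_join_left t (CutFree.refl s)
  | le_join_right s t => exact CutFree.le_join_right s (CutFree.refl t)
  | join_le _ _ h k => exact CutFree.join_le h k
  | meet_le_left s t => exact CutFree.meet_le_left t (CutFree.refl s)
  | meet_le_right s t => exact CutFree.meet_le_right s (CutFree.refl t)
  | le_meet _ _ h k => exact CutFree.le_meet h k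

end LatticeTerm

namespace FreeLattice

variable {X : Type*}

/-- The generators of a free lattice are join-prime. -/
theorem of_le_sup {x : X} {a b : FreeLattice X} (h : of x ≤ a ⊔ b) : of x ≤ a ∨ of x ≤ b := by
  obtain ⟨s⟩ := a
  obtain ⟨t⟩ := b
  cases LatticeTerm.Le.cutFree h with
  | le_join_left _ h => exact Or.inl h.le
  | le_join_right _ h => exact Or.inr h.le

/-- Whitman's condition. -/
theorem inf_le_sup {a b c d : FreeLattice X} (h : a ⊓ b ≤ c ⊔ d) :
    (a ≤ c ⊔ d ∨ b ≤ c ⊔ d) ∨ a ⊓ b ≤ c ∨ a ⊓ b ≤ d := by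
  obtain ⟨a⟩ := a
  obtain ⟨b⟩ := b
  obtain ⟨c⟩ := c
  obtain ⟨d⟩ := d
  cases LatticeTerm.Le.cutFree h with
  | meet_le_left _ h => exact Or.inl (Or.inl h.le)
  | meet_le_right _ h => exact Or.inl (Or.inr h.le)
  | le_join_left _ h => exact Or.inr (Or.inl h.le)
  | le_join_right _ h => exact Or.inr (Or.inr h.le)

end FreeLattice

/-! ### Meets of decreasing sequences in free lattices -/

/-- If each term of a decreasing sequence is above `a` or above `b`, then one of the two is a lower
bound of the sequence. -/
theorem Antitone.forall_le_or_forall_le {L : Type*} [Preorder L] {w : ℕ → L} (hw : Antitone w)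
    {a b : L} (h : ∀ n, a ≤ w n ∨ b ≤ w n) : (∀ n, a ≤ w n) ∨ ∀ n, b ≤ w n := by
  by_contra! hc
  obtain ⟨⟨i, hi⟩, j, hj⟩ := hc
  rcases h (max i j) with h | h
  · exact hi (h.trans (hw (le_max_left i j)))
  · exact hj (h.trans (hw (le_max_right i j)))

/-- The sequence `y₀ = y`, `yₙ₊₁ = y ⊓ (x ⊔ zₙ)`, where `zₙ` is the same sequence with `y` and `z`
exchanged. -/
def jsdSeq {L : Type*} [Lattice L] (x : L) : ℕ → L → L → L
  | 0, y, _ => y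
  | n + 1, y, z => y ⊓ (x ⊔ jsdSeq x n z y)

section jsdSeq

variable {L : Type*} [Lattice L] (x y z : L)

theorem jsdSeq_succ_le (n : ℕ) : jsdSeq x (n + 1) y z ≤ jsdSeq x n y z := by
  induction n generalizing y z with
  | zero => exact inf_le_left
  | succ n ih => exact inf_le_inf_left _ (sup_le_sup_left (ih z y) _)

theorem antitone_sup_jsdSeq : Antitone fun n => x ⊔ jsdSeq x n y z :=
  antitone_nat_of_succ_le fun n => sup_le_sup_left (jsdSeq_succ_le x y z n) _

theorem inf_le_jsdSeq (n : ℕ) : y ⊓ z ≤ jsdSeq x n y z := by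
  induction n generalizing y z with
  | zero => exact inf_le_left
  | succ n ih => exact le_inf inf_le_left (le_sup_of_le_right (inf_comm y z ▸ ih z y))

theorem jsdSeq_le (n : ℕ) : jsdSeq x n y z ≤ y := by
  cases n with
  | zero => exact le_rfl
  | succ n => exact inf_le_left

theorem le_sup_jsdSeq_swap {x y z a : L} (h : ∀ n, a ≤ x ⊔ jsdSeq x n y z) (n : ℕ) :
    a ≤ x ⊔ jsdSeq x n z y :=
  (h (n + 1)).trans (sup_le le_sup_left inf_le_right)

theorem map_jsdSeq {K : Type*} [Lattice K] (f : LatticeHom L K) (n : ℕ) :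
    f (jsdSeq x n y z) = jsdSeq (f x) n (f y) (f z) := by
  induction n generalizing y z with
  | zero => rfl
  | succ n ih => simp only [jsdSeq, map_inf, map_sup, ih]

end jsdSeq

namespace FreeLattice

variable {X : Type*}

theorem isGLB_sup_left (c : FreeLattice X) {w : ℕ → FreeLattice X} (hw : Antitone w)
    {m : FreeLattice X} (hm : IsGLB (Set.range w) m) :
    IsGLB (Set.range fun n => c ⊔ w n) (c ⊔ m) := by
  refine ⟨Set.forall_mem_range.2 fun n => sup_le_sup_left (hm.1 ⟨n, rfl⟩) _, fun a ha => ?_⟩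
  replace ha : ∀ n, a ≤ c ⊔ w n := Set.forall_mem_range.1 ha
  have key {a : FreeLattice X} (h : ∀ n, a ≤ w n) : a ≤ c ⊔ m :=
    le_sup_of_le_right (hm.2 (Set.forall_mem_range.2 h))
  induction a using FreeLattice.induction with
  | hof x =>
    by_cases hc : of x ≤ c
    · exact le_sup_of_le_left hc
    · exact key fun n => (of_le_sup (ha n)).resolve_left hc
  | hsup a b iha ihb =>
    exact sup_le (iha fun n => le_sup_left.trans (ha n)) (ihb fun n => le_sup_right.trans (ha n))
  | hinf a b iha ihb =>
    by_cases hc : a ⊓ b ≤ c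
    · exact le_sup_of_le_left hc
    by_cases hab : ∀ n, a ⊓ b ≤ w n
    · exact key hab
    -- Beyond an index where `a ⊓ b ≤ w n` fails, only the first two cases of Whitman's condition
    -- remain; they then hold at all indices, the sequence being decreasing.
    push Not at hab
    obtain ⟨k, hk⟩ := hab
    have h (n : ℕ) : a ≤ c ⊔ w n ∨ b ≤ c ⊔ w n := by
      have hle : c ⊔ w (max k n) ≤ c ⊔ w n := sup_le_sup_left (hw (le_max_right k n)) _
      rcases inf_le_sup (ha (max k n)) with h | h | h
      · exact h.imp hle.trans' hle.trans'
      · exact absurd h hc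
      · exact absurd (h.trans (hw (le_max_left k n))) hk
    rcases Antitone.forall_le_or_forall_le (fun i j hij => sup_le_sup_left (hw hij) c) h with h | h
    · exact inf_le_left.trans (iha h)
    · exact inf_le_right.trans (ihb h)

theorem isGLB_sup_jsdSeq (x y z : FreeLattice X) :
    IsGLB (Set.range fun n => x ⊔ jsdSeq x n y z) (x ⊔ (y ⊓ z)) := by
  refine ⟨Set.forall_mem_range.2 fun n => sup_le_sup_left (inf_le_jsdSeq x y z n) _, fun a ha => ?_⟩
  replace ha : ∀ n, a ≤ x ⊔ jsdSeq x n y z := Set.forall_mem_range.1 ha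
  induction a using FreeLattice.induction generalizing y z with
  | hof i =>
    by_cases hx : of i ≤ x
    · exact le_sup_of_le_left hx
    · exact le_sup_of_le_right (le_inf ((of_le_sup (ha 0)).resolve_left hx)
        ((of_le_sup (le_sup_jsdSeq_swap ha 0)).resolve_left hx))
  | hsup a b iha ihb =>
    exact sup_le (iha y z fun n => le_sup_left.trans (ha n))
      (ihb y z fun n => le_sup_right.trans (ha n))
  | hinf a b iha ihb =>
    by_cases hx : a ⊓ b ≤ x
    · exact le_sup_of_le_left hx
    have key (y z : FreeLattice X) (ha : ∀ n, a ⊓ b ≤ x ⊔ jsdSeq x n y z) (hy : ¬ a ⊓ b ≤ y) :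
        a ⊓ b ≤ x ⊔ (y ⊓ z) := by
      have h (n : ℕ) : a ≤ x ⊔ jsdSeq x n y z ∨ b ≤ x ⊔ jsdSeq x n y z := by
        rcases inf_le_sup (ha n) with h | h | h
        · exact h
        · exact absurd h hx
        · exact absurd (h.trans (jsdSeq_le x y z n)) hy
      rcases (antitone_sup_jsdSeq x y z).forall_le_or_forall_le h with h | h
      · exact inf_le_left.trans (iha y z h)
      · exact inf_le_right.trans (ihb y z h)
    by_cases hy : a ⊓ b ≤ y
    · by_cases hz : a ⊓ b ≤ z
      · exact le_sup_of_le_right (le_inf hy hz)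
      · exact inf_comm y z ▸ key z y (le_sup_jsdSeq_swap ha) hz
    · exact key y z ha hy

end FreeLattice

/-! ### Stable meets -/

/-- The unary polynomials obtained from the identity by repeatedly joining or meeting with a
constant. -/
inductive IsTranslation {L : Type*} [Lattice L] : (L → L) → Prop
  | id : IsTranslation fun x => x
  | sup (c : L) {t : L → L} : IsTranslation t → IsTranslation fun x => c ⊔ t x
  | inf (c : L) {t : L → L} : IsTranslation t → IsTranslation fun x => c ⊓ t x

/-- `m` is the meet of the sequence `w`, and every translation preserves this meet. -/
def IsStableMeet {L : Type*} [Lattice L] (w : ℕ → L) (m : L) : Prop :=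
  ∀ t : L → L, IsTranslation t → IsGLB (Set.range fun n => t (w n)) (t m)

section Stable

variable {L : Type*} [Lattice L]

theorem IsTranslation.comp {s t : L → L} (hs : IsTranslation s) (ht : IsTranslation t) :
    IsTranslation fun x => s (t x) := by
  induction hs with
  | id => exact ht
  | sup c _ ih => exact ih.sup c
  | inf c _ ih => exact ih.inf c

theorem IsTranslation.monotone {t : L → L} (ht : IsTranslation t) : Monotone t := by
  induction ht with
  | id => exact monotone_id
  | sup c _ ih => exact fun _ _ h => sup_le_sup_left (ih h) c
  | inf c _ ih => exact fun _ _ h => inf_le_inf_left c (ih h)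

theorem IsStableMeet.translate {w : ℕ → L} {m : L} (h : IsStableMeet w m) {t : L → L}
    (ht : IsTranslation t) : IsStableMeet (fun n => t (w n)) (t m) :=
  fun _ hs => h _ (hs.comp ht)

theorem FreeLattice.isStableMeet {X : Type*} {w : ℕ → FreeLattice X} (hw : Antitone w)
    {m : FreeLattice X} (hm : IsGLB (Set.range w) m) : IsStableMeet w m := by
  intro t ht
  induction ht with
  | id => exact hm
  | sup c ht ih => exact isGLB_sup_left c (fun i j hij => ht.monotone (hw hij)) ih
  | inf c _ ih =>
    refine ⟨Set.forall_mem_range.2 fun n => inf_le_inf_left _ (ih.1 ⟨n, rfl⟩), fun a ha => ?_⟩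
    replace ha := Set.forall_mem_range.1 ha
    exact le_inf ((ha 0).trans inf_le_left)
      (ih.2 (Set.forall_mem_range.2 fun n => (ha n).trans inf_le_right))

/-- Finitely many elements and the constants of a translation can be lifted together to a finitely
generated free lattice. -/
theorem IsTranslation.exists_lift {t : L → L} (ht : IsTranslation t) (l : List L) :
    ∃ (n : ℕ) (f : LatticeHom (FreeLattice (Fin n)) L)
      (s : FreeLattice (Fin n) → FreeLattice (Fin n)),
      IsTranslation s ∧ (∀ a, f (s a) = t (f a)) ∧ ∀ b ∈ l, ∃ a, f a = b := by
  induction ht generalizing l with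
  | id =>
    refine ⟨l.length, FreeLattice.lift l.get, _, .id, fun a => rfl, fun b hb => ?_⟩
    obtain ⟨i, rfl⟩ := List.get_of_mem hb
    exact ⟨FreeLattice.of i, rfl⟩
  | sup c _ ih =>
    obtain ⟨n, f, s, hs, hf, hl⟩ := ih (c :: l)
    obtain ⟨d, hd⟩ := hl c List.mem_cons_self
    exact ⟨n, f, _, hs.sup d, fun a => by rw [map_sup, hd, hf],
      fun b hb => hl b (List.mem_cons_of_mem c hb)⟩
  | inf c _ ih =>
    obtain ⟨n, f, s, hs, hf, hl⟩ := ih (c :: l)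
    obtain ⟨d, hd⟩ := hl c List.mem_cons_self
    exact ⟨n, f, _, hs.inf d, fun a => by rw [map_inf, hd, hf],
      fun b hb => hl b (List.mem_cons_of_mem c hb)⟩

/-- A lower bound `b` in `L` is carried to the free lattice by the least element of the preimage of
the filter above `b`. -/
theorem IsLowerBoundedLattice.isStableMeet_sup_jsdSeq (hL : IsLowerBoundedLattice L) (x y z : L) :
    IsStableMeet (fun n => x ⊔ jsdSeq x n y z) (x ⊔ (y ⊓ z)) := by
  intro t ht
  refine ⟨Set.forall_mem_range.2 fun n =>
    ht.monotone (sup_le_sup_left (inf_le_jsdSeq x y z n) _), fun b hb => ?_⟩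
  replace hb := Set.forall_mem_range.1 hb
  obtain ⟨n, f, s, hs, hf, hl⟩ := ht.exists_lift [x, y, z]
  obtain ⟨x, rfl⟩ := hl x (by simp)
  obtain ⟨y, rfl⟩ := hl y (by simp)
  obtain ⟨z, rfl⟩ := hl z (by simp)
  have hmem (k : ℕ) : s (x ⊔ jsdSeq x k y z) ∈ f ⁻¹' Set.Ici b := by
    simpa only [Set.mem_preimage, Set.mem_Ici, hf, map_sup, map_jsdSeq] using hb k
  rcases hL n f b with h | ⟨a, ha⟩
  · exact absurd (hmem 0) (h ▸ Set.notMem_empty _)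
  · have hle : a ≤ s (x ⊔ (y ⊓ z)) :=
      (FreeLattice.isStableMeet (antitone_sup_jsdSeq x y z)
        (FreeLattice.isGLB_sup_jsdSeq x y z) s hs).2
        (Set.forall_mem_range.2 fun k => ha.2 (hmem k))
    have : b ≤ f (s (x ⊔ (y ⊓ z))) := le_trans ha.1 (OrderHomClass.mono f hle)
    simpa only [hf, map_sup, map_inf] using this

end Stable

/-! ### The lattice of stable filters -/

/-- An upper set that contains the stable meet of every sequence of its elements. -/
structure IsStableUpperSet {L : Type*} [Lattice L] (C : Set L) : Prop where
  isUpperSet : IsUpperSet C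
  mem_of_isStableMeet : ∀ {w : ℕ → L} {m : L}, IsStableMeet w m → (∀ n, w n ∈ C) → m ∈ C

theorem IsStableUpperSet.preimage {L : Type*} [Lattice L] {C : Set L} (hC : IsStableUpperSet C)
    {t : L → L} (ht : IsTranslation t) : IsStableUpperSet (t ⁻¹' C) where
  isUpperSet := hC.isUpperSet.preimage ht.monotone
  mem_of_isStableMeet h hw := hC.mem_of_isStableMeet (h.translate ht) hw

/-- A stable upper set closed under binary meets; it may be empty. -/
structure StableFilter (L : Type*) [Lattice L] where
  /-- The underlying set. -/
  carrier : Set L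
  isStableUpperSet : IsStableUpperSet carrier
  infClosed : InfClosed carrier

namespace StableFilter

variable {L : Type*} [Lattice L]

instance : SetLike (StableFilter L) L where
  coe := carrier
  coe_injective := by rintro ⟨_, _, _⟩ ⟨_, _, _⟩ h; congr

/-- Stable filters are ordered by reverse inclusion. -/
instance : PartialOrder (StableFilter L) where
  le F G := ∀ x ∈ G, x ∈ F
  le_refl _ _ h := h
  le_trans _ _ _ h k x hx := h x (k x hx)
  le_antisymm _ _ h k := SetLike.ext fun x => ⟨k x, h x⟩

theorem le_def {F G : StableFilter L} : F ≤ G ↔ ∀ x ∈ G, x ∈ F := Iff.rfl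

instance : SupSet (StableFilter L) where
  sSup S :=
    { carrier := {x | ∀ F ∈ S, x ∈ F}
      isStableUpperSet :=
        { isUpperSet := fun _ _ h hx F hF => F.isStableUpperSet.isUpperSet h (hx F hF)
          mem_of_isStableMeet := fun h hw F hF =>
            F.isStableUpperSet.mem_of_isStableMeet h fun n => hw n F hF }
      infClosed := fun _ hx _ hy F hF => F.infClosed (hx F hF) (hy F hF) }

instance : CompleteLattice (StableFilter L) :=
  completeLatticeOfSup _ fun _ =>
    ⟨fun F hF _ hx => hx F hF, fun _ hG x hx _ hF => hG hF x hx⟩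

theorem mem_sup {F G : StableFilter L} {x : L} : x ∈ F ⊔ G ↔ x ∈ F ∧ x ∈ G := by
  refine ⟨fun h => ⟨le_def.1 le_sup_left x h, le_def.1 le_sup_right x h⟩, fun h => ?_⟩
  let H : StableFilter L :=
    { carrier := {x | x ∈ F ∧ x ∈ G}
      isStableUpperSet :=
        { isUpperSet := fun _ _ h hx =>
            ⟨F.isStableUpperSet.isUpperSet h hx.1, G.isStableUpperSet.isUpperSet h hx.2⟩
          mem_of_isStableMeet := fun h hw =>
            ⟨F.isStableUpperSet.mem_of_isStableMeet h fun n => (hw n).1,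
              G.isStableUpperSet.mem_of_isStableMeet h fun n => (hw n).2⟩ }
      infClosed := fun _ hx _ hy => ⟨F.infClosed hx.1 hy.1, G.infClosed hx.2 hy.2⟩ }
  exact (sup_le (fun _ h => h.1) (fun _ h => h.2) : F ⊔ G ≤ H) x h

/-- The least stable upper set that contains a given set closed under meets; it is again closed
under meets. -/
def generate (U : Set L) (hU : InfClosed U) : StableFilter L where
  carrier := {x | ∀ C : Set L, IsStableUpperSet C → U ⊆ C → x ∈ C}
  isStableUpperSet :=
    { isUpperSet := fun _ _ h hx C hC hUC => hC.isUpperSet h (hx C hC hUC)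
      mem_of_isStableMeet := fun h hw C hC hUC =>
        hC.mem_of_isStableMeet h fun n => hw n C hC hUC }
  infClosed := fun x hx y hy C hC hUC =>
    -- Both arguments are treated as variables in turn: `y` for a fixed element of `U`, then `x`.
    hy _ (hC.preimage (.inf x .id)) fun u hu => by
      have := hx _ (hC.preimage (.inf u .id)) fun v hv => hUC (hU hu hv)
      simpa only [Set.mem_preimage, inf_comm] using this

/-- Induction principle for the elements of a stable filter: if `F` is above the stable filter
generated by `U`, then every stable upper set that contains `U` contains `F`. -/
theorem mem_of_generate_le {U : Set L} (hU : InfClosed U) {F : StableFilter L}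
    (hF : generate U hU ≤ F) {C : Set L} (hC : IsStableUpperSet C) (hUC : U ⊆ C) {x : L}
    (hx : x ∈ F) : x ∈ C :=
  hF x hx C hC hUC

theorem subset_generate {U : Set L} (hU : InfClosed U) {x : L} (hx : x ∈ U) : x ∈ generate U hU :=
  fun _ _ hUC => hUC hx

theorem isLowerContinuous : IsLowerContinuous (StableFilter L) := by
  intro F S _ hS G hG
  refine ⟨?_, fun K hK p hp => ?_⟩
  · rintro _ ⟨H, hH, rfl⟩
    exact sup_le_sup_left (hG.1 hH) _
  have hU : InfClosed {x : L | ∃ H ∈ S, x ∈ H} := by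
    rintro x ⟨H, hH, hx⟩ y ⟨I, hI, hy⟩
    obtain ⟨J, hJ, hJH, hJI⟩ := hS H hH I hI
    exact ⟨J, hJ, J.infClosed (le_def.1 hJH x hx) (le_def.1 hJI y hy)⟩
  have hle : generate _ hU ≤ G := hG.2 fun H hH x hx => subset_generate hU ⟨H, hH, hx⟩
  rw [mem_sup] at hp
  have := mem_of_generate_le hU hle (K.isStableUpperSet.preimage (.sup p .id)) (by
    rintro q ⟨H, hH, hq⟩
    refine hK ⟨H, hH, rfl⟩ (p ⊔ q) (mem_sup.2 ⟨?_, ?_⟩)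
    · exact F.isStableUpperSet.isUpperSet le_sup_left hp.1
    · exact H.isStableUpperSet.isUpperSet le_sup_right hq) hp.2
  rwa [Set.mem_preimage, sup_idem] at this

theorem isJoinSemidistributive
    (hL : ∀ x y z : L, IsStableMeet (fun n => x ⊔ jsdSeq x n y z) (x ⊔ (y ⊓ z))) :
    IsJoinSemidistributive (StableFilter L) := by
  intro F G H hGH
  have hG {p q : L} (hp : p ∈ F) (hq : q ∈ G) : p ⊔ q ∈ F ⊔ G :=
    mem_sup.2 ⟨F.isStableUpperSet.isUpperSet le_sup_left hp,
      G.isStableUpperSet.isUpperSet le_sup_right hq⟩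
  have hH {p q : L} (hp : p ∈ F) (hq : q ∈ H) : p ⊔ q ∈ F ⊔ G :=
    hGH ▸ mem_sup.2 ⟨F.isStableUpperSet.isUpperSet le_sup_left hp,
      H.isStableUpperSet.isUpperSet le_sup_right hq⟩
  refine le_antisymm (fun p hp => ?_) (sup_le_sup_left inf_le_left _)
  rw [mem_sup] at hp
  -- The empty filter is the top element, and then the meet is just the other filter.
  by_cases hGe : ∃ g, g ∈ G
  swap
  · have : H ≤ G := fun g hg => absurd ⟨g, hg⟩ hGe
    rw [inf_eq_right.2 this] at hp
    exact hGH ▸ mem_sup.2 hp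
  by_cases hHe : ∃ h, h ∈ H
  swap
  · have : G ≤ H := fun h hh => absurd ⟨h, hh⟩ hHe
    rw [inf_eq_left.2 this] at hp
    exact mem_sup.2 hp
  obtain ⟨g₀, hg₀⟩ := hGe
  obtain ⟨h₀, hh₀⟩ := hHe
  have hU : InfClosed {x : L | ∃ g ∈ G, ∃ h ∈ H, g ⊓ h ≤ x} := by
    rintro x ⟨g, hg, h, hh, hx⟩ y ⟨g', hg', h', hh', hy⟩
    exact ⟨g ⊓ g', G.infClosed hg hg', h ⊓ h', H.infClosed hh hh',
      (inf_inf_inf_comm g g' h h').trans_le (inf_le_inf hx hy)⟩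
  have hle : generate _ hU ≤ G ⊓ H :=
    le_inf (fun g hg => subset_generate hU ⟨g, hg, h₀, hh₀, inf_le_left⟩)
      (fun h hh => subset_generate hU ⟨g₀, hg₀, h, hh, inf_le_right⟩)
  have := mem_of_generate_le hU hle ((F ⊔ G).isStableUpperSet.preimage (.sup p .id)) (by
    rintro q ⟨g, hg, h, hh, hq⟩
    have hseq (n : ℕ) : jsdSeq p n g h ∈ G ∧ jsdSeq p n h g ∈ H := by
      induction n with
      | zero => exact ⟨hg, hh⟩
      | succ n ih =>
        refine ⟨G.infClosed hg (mem_sup.1 (hH hp.1 ih.2)).2, H.infClosed hh ?_⟩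
        have := hG hp.1 ih.1
        rw [hGH] at this
        exact (mem_sup.1 this).2
    exact (F ⊔ G).isStableUpperSet.isUpperSet (sup_le_sup_left hq p)
      ((F ⊔ G).isStableUpperSet.mem_of_isStableMeet (hL p g h) fun n => hG hp.1 (hseq n).1)) hp.2
  rwa [Set.mem_preimage, sup_idem] at this

/-- The principal filter of `a`. -/
def principal (a : L) : StableFilter L where
  carrier := Set.Ici a
  isStableUpperSet :=
    { isUpperSet := isUpperSet_Ici a
      mem_of_isStableMeet := fun h hw => (h _ .id).2 (Set.forall_mem_range.2 hw) }
  infClosed := fun _ hx _ hy => le_inf hx hy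

theorem mem_principal {a x : L} : x ∈ principal a ↔ a ≤ x := Iff.rfl

theorem principal_le_iff {a : L} {F : StableFilter L} : F ≤ principal a ↔ a ∈ F :=
  ⟨fun h => h a (mem_principal.2 le_rfl), fun h _ hx => F.isStableUpperSet.isUpperSet hx h⟩

/-- The embedding of `L` by principal filters. -/
def principalHom (L : Type*) [Lattice L] : LatticeHom L (StableFilter L) where
  toFun := principal
  map_sup' a b := SetLike.ext fun x => by simp only [mem_sup, mem_principal, sup_le_iff]
  map_inf' a b := eq_of_forall_le_iff fun F => by
    simp only [le_inf_iff, principal_le_iff]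
    exact ⟨fun h => ⟨F.isStableUpperSet.isUpperSet inf_le_left h,
      F.isStableUpperSet.isUpperSet inf_le_right h⟩, fun h => F.infClosed h.1 h.2⟩

theorem principalHom_injective : Function.Injective (principalHom L) := fun a b h =>
  le_antisymm (principal_le_iff.1 (show principal a ≤ principal b from h.le))
    (principal_le_iff.1 (show principal b ≤ principal a from h.ge))

end StableFilter

theorem corollaryC (L : Type u) [Lattice L] (hL : IsLowerBoundedLattice L) :
    ∃ (M : Type u) (_ : CompleteLattice M),
      IsLowerContinuous M ∧ IsJoinSemidistributive M ∧
        ∃ f : LatticeHom L M, Function.Injective f :=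
  ⟨StableFilter L, inferInstance, StableFilter.isLowerContinuous,
    StableFilter.isJoinSemidistributive hL.isStableMeet_sup_jsdSeq,
    StableFilter.principalHom L, StableFilter.principalHom_injective⟩
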